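/- Let $\mathcal U$ be a real separable Hilbert space with its Borel $\sigma$-algebra and let $p\in[1,\infty)$. Let $\mathscr P_p(\mathcal U)$ be the set of Borel probability measures $\mu$ on $\mathcal U$ with $\int\|u\|^p\,\mu(du)<\infty$. For probability measures $\mu,\nu$ on a space $X$ with a $\sigma$-algebra and a metric $d$, write $$W_p(\mu,\nu)=\Bigl(\inf_{\gamma\in\Gamma(\mu,\nu)}\int_{X\times X}d(x,y)^p\,\gamma(dx,dy)\Bigr)^{1/p},$$ where $\Gamma(\mu,\nu)$ is the set of probability measures on $X\times X$ with marginals $\mu$ and $\nu$. Equip $\mathscr P_p(\mathcal U)$ with the metric $W_p$ (for $X=\mathcal U$ with the norm metric) and with the $\sigma$-algebra generated by the evaluation maps $\mu\mapsto\mu(A)$, $A\subseteq\mathcal U$ Borel. Let $\mathscr P_p(\mathscr P_p(\mathcal U))$ be the set of probability measures $\mathbb Q$ on $\mathscr P_p(\mathcal U)$ with $\int W_p(\mu,\mu_0)^p\,\mathbb Q(d\mu)<\infty$ for some $\mu_0\in\mathscr P_p(\mathcal U)$. The mixture $\mathbb E_{\mu\sim\mathbb Q}\,\mu$ is the measure $A\mapsto\int\mu(A)\,\mathbb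 Q(d\mu)$ on $\mathcal U$. If $\mathbb Q,\mathbb Q'\in\mathscr P_p(\mathscr P_p(\mathcal U))$, then $\mathbb E_{\mu\sim\mathbb Q}\,\mu$ and $\mathbb E_{\nu\sim\mathbb Q'}\,\nu$ belong to $\mathscr P_p(\mathcal U)$, $W_p(\mathbb Q,\mathbb Q')$ is finite, and $$W_p\bigl(\mathbb E_{\mu\sim\mathbb Q}\,\mu,\ \mathbb E_{\nu\sim\mathbb Q'}\,\nu\bigr)\le W_p(\mathbb Q,\mathbb Q'),$$ where the Wasserstein distance on the right-hand side is taken over the ground space $X=(\mathscr P_p(\mathcal U),W_p)$. -/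

import Mathlib

open MeasureTheory
open scoped ENNReal

noncomputable section

/-- The couplings `Γ(μ, ν)`: probability measures on `X × X` with marginals `μ` and `ν`. -/
def couplings {X : Type*} [MeasurableSpace X] (μ ν : Measure X) : Set (Measure (X × X)) :=
  {γ | IsProbabilityMeasure γ ∧ γ.map Prod.fst = μ ∧ γ.map Prod.snd = ν}

/-- The `p`-Wasserstein distance with respect to the ground distance `edist` of `X`,
`(inf_{γ ∈ Γ(μ, ν)} ∫ d(x, y) ^ p dγ) ^ (1 / p)`, with values in `[0, ∞]`. -/
def wasserstein {X : Type*} [MeasurableSpace X] [EDist X] (p : ℝ) (μ ν : Measure X) : ℝ≥0∞ :=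
  (⨅ γ ∈ couplings μ ν, ∫⁻ z, edist z.1 z.2 ^ p ∂γ) ^ (1 / p)

/-- The uncentered `p`-th moment `∫ ‖u‖ ^ p dμ`. -/
def pMoment {U : Type*} [MeasurableSpace U] [NormedAddCommGroup U] (p : ℝ) (μ : Measure U) :
    ℝ≥0∞ :=
  ∫⁻ u, ‖u‖ₑ ^ p ∂μ

/-- Membership in `𝒫_p(U)`: probability measures on `U` with finite `p`-th moment. -/
def MemPp {U : Type*} [MeasurableSpace U] [NormedAddCommGroup U] (p : ℝ) (μ : Measure U) : Prop :=
  IsProbabilityMeasure μ ∧ pMoment p μ < ∞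

/-- The Wasserstein space `𝒫_p(U)`. -/
def WassersteinSpace (p : ℝ) (U : Type*) [MeasurableSpace U] [NormedAddCommGroup U] : Type _ :=
  {μ : Measure U // MemPp p μ}

/-- The measure underlying a point of the Wasserstein space. -/
def WassersteinSpace.toMeasure {p : ℝ} {U : Type*} [MeasurableSpace U] [NormedAddCommGroup U]
    (μ : WassersteinSpace p U) : Measure U :=
  μ.val

/-- `𝒫_p(U)` carries the σ-algebra generated by the evaluation maps `μ ↦ μ A`, `A` measurable. -/
instance WassersteinSpace.instMeasurableSpace (p : ℝ) (U : Type*) [MeasurableSpace U]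
    [NormedAddCommGroup U] : MeasurableSpace (WassersteinSpace p U) :=
  MeasurableSpace.comap WassersteinSpace.toMeasure Measure.instMeasurableSpace

/-- `𝒫_p(U)` carries the ground distance `W_p`. -/
instance WassersteinSpace.instEDist (p : ℝ) (U : Type*) [MeasurableSpace U]
    [NormedAddCommGroup U] : EDist (WassersteinSpace p U) :=
  ⟨fun μ ν => wasserstein p μ.toMeasure ν.toMeasure⟩

/-- Membership in `𝒫_p(𝒫_p(U))`: probability measures `Q` on `𝒫_p(U)` such that
`∫ W_p(μ, μ₀) ^ p dQ(μ) < ∞` for some `μ₀`. -/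
def MemPpPp {p : ℝ} {U : Type*} [MeasurableSpace U] [NormedAddCommGroup U]
    (Q : Measure (WassersteinSpace p U)) : Prop :=
  IsProbabilityMeasure Q ∧ ∃ μ₀ : WassersteinSpace p U, ∫⁻ μ, edist μ μ₀ ^ p ∂Q < ∞

/-- The mixture `E_{μ ∼ Q} μ`, that is, the measure `A ↦ ∫ μ(A) dQ(μ)`. -/
def mixture {p : ℝ} {U : Type*} [MeasurableSpace U] [NormedAddCommGroup U]
    (Q : Measure (WassersteinSpace p U)) : Measure U :=
  Q.bind WassersteinSpace.toMeasure

theorem WassersteinSpace.measurable_toMeasure {p : ℝ} {U : Type*} [MeasurableSpace U]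
    [NormedAddCommGroup U] :
    Measurable (WassersteinSpace.toMeasure : WassersteinSpace p U → Measure U) :=
  comap_measurable _

theorem mixture_apply {p : ℝ} {U : Type*} [MeasurableSpace U] [NormedAddCommGroup U]
    (Q : Measure (WassersteinSpace p U)) {A : Set U} (hA : MeasurableSet A) :
    mixture Q A = ∫⁻ μ, μ.toMeasure A ∂Q :=
  Measure.bind_apply hA WassersteinSpace.measurable_toMeasure.aemeasurable

end

/-!
The distance `W_p(μ, ν)` is not obviously measurable in `(μ, ν)`, so that its integral against a
coupling `Γ` of `Q` and `Q'` is a priori only a lower integral, and a measurable choice of optimal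
couplings of `μ` and `ν` is delicate. Both difficulties are avoided by a reduction to transport
problems on a finite set.

Choose a map `T` of finite range which is `L^p`-close to the identity for both mixtures, and let
`A_i` be its fibres. The vectors `(μ(A_i))` and `(ν(A_j))` are the data of a finite transport problem
whose minimal cost `f(μ, ν)` has a convex and closed epigraph. So `f` is measurable, and the mean of
`(μ(A_i), ν(A_j), f(μ, ν))` under `Γ` lies again in the epigraph
(`exists_isTransportPlan_integral`): there is a plan between the masses which the two mixtures give
to the cells, of cost at most `∫ f dΓ`. By taking products of conditional measures on the cells it
becomes a coupling of the mixtures (`exists_mem_couplings_of_isTransportPlan`), and Minkowski's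
inequality bounds the distance of the mixtures by `(∫ f dΓ) ^ (1 / p)` plus the two errors
`‖u - T u‖_{L^p}` (`wasserstein_le_of_isTransportPlan`).

Conversely every coupling of `μ` and `ν` induces a plan between the cell masses, so that
`f(μ, ν) ^ (1 / p)` is at most `W_p(μ, ν)` plus the errors of `μ` and `ν`
(`tsub_approxError_le_wasserstein`). Taking `L^p(Γ)` norms, the errors of the components integrate to
those of the mixtures (`lintegral_approxError_rpow`). As the errors are arbitrarily small, the
inequality follows (`wasserstein_mixture_le`). The finiteness claims come from the product
coupling and the triangle inequality for `p`-th moments.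
-/

/-! ### Finite transport plans -/

/-- `π` is a transport plan between the weights `a` and `b` on the finite set `ι`: a probability
vector on `ι × ι` with marginals `a` and `b`. -/
def IsTransportPlan {ι : Type*} [Fintype ι] (a b : ι → ℝ) (π : ι × ι → ℝ) : Prop :=
  π ∈ stdSimplex ℝ (ι × ι) ∧ (∀ i, ∑ j, π (i, j) = a i) ∧ ∀ j, ∑ i, π (i, j) = b j

/-- The triples `(a, b, t)` such that some transport plan between `a` and `b` has cost at most `t`,
that is, the epigraph of the minimal transport cost. -/
def transportEpigraph {ι : Type*} [Fintype ι] (c : ι × ι → ℝ) :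
    Set ((ι → ℝ) × (ι → ℝ) × ℝ) :=
  {z | ∃ π, IsTransportPlan z.1 z.2.1 π ∧ ∑ q, c q * π q ≤ z.2.2}

theorem isClosed_transportEpigraph {ι : Type*} [Fintype ι] (c : ι × ι → ℝ) :
    IsClosed (transportEpigraph c) := by
  -- the projection along the compact simplex is a closed map
  have hS : IsClosed {w : stdSimplex ℝ (ι × ι) × ((ι → ℝ) × (ι → ℝ) × ℝ) |
      ((∀ i, ∑ j, w.1.1 (i, j) = w.2.1 i) ∧ ∀ j, ∑ i, w.1.1 (i, j) = w.2.2.1 j) ∧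
        ∑ q, c q * w.1.1 q ≤ w.2.2.2} := by
    have hπ : ∀ q, Continuous fun w : stdSimplex ℝ (ι × ι) × ((ι → ℝ) × (ι → ℝ) × ℝ) =>
        w.1.1 q := fun q => (continuous_apply q).comp (continuous_subtype_val.comp continuous_fst)
    refine IsClosed.and (IsClosed.and ?_ ?_) ?_
    · simp only [Set.ofPred_forall]
      exact isClosed_iInter fun i => isClosed_eq (by fun_prop) (by fun_prop)
    · simp only [Set.ofPred_forall]
      exact isClosed_iInter fun i => isClosed_eq (by fun_prop) (by fun_prop)
    · exact isClosed_le (by fun_prop) (by fun_prop)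
  have := isClosedMap_snd_of_compactSpace _ hS
  convert this using 1
  ext z
  constructor
  · rintro ⟨π, ⟨h1, h2, h3⟩, h4⟩
    exact ⟨⟨⟨π, h1⟩, z⟩, ⟨⟨h2, h3⟩, h4⟩, rfl⟩
  · rintro ⟨⟨π, z'⟩, ⟨⟨h2, h3⟩, h4⟩, rfl⟩
    exact ⟨π.1, ⟨π.2, h2, h3⟩, h4⟩

theorem convex_transportEpigraph {ι : Type*} [Fintype ι] (c : ι × ι → ℝ) :
    Convex ℝ (transportEpigraph c) := by
  rintro z ⟨π, ⟨h1, h2, h3⟩, h4⟩ z' ⟨π', ⟨h1', h2', h3'⟩, h4'⟩ s t hs ht hst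
  refine ⟨s • π + t • π', ⟨convex_stdSimplex ℝ _ h1 h1' hs ht hst, fun i => ?_, fun i => ?_⟩, ?_⟩
  · simp [Finset.sum_add_distrib, ← Finset.mul_sum, h2, h2']
  · simp [Finset.sum_add_distrib, ← Finset.mul_sum, h3, h3']
  · have : ∑ q, c q * (s • π + t • π') q = s * ∑ q, c q * π q + t * ∑ q, c q * π' q := by
      simp only [Finset.mul_sum, ← Finset.sum_add_distrib]
      refine Finset.sum_congr rfl fun q _ => ?_
      simp only [Pi.add_apply, Pi.smul_apply, smul_eq_mul]
      ring
    rw [this]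
    simp only [Prod.snd_add, Prod.smul_snd, smul_eq_mul]
    gcongr

theorem IsTransportPlan.mem_Icc {ι : Type*} [Fintype ι] {a b : ι → ℝ} {π : ι × ι → ℝ}
    (h : IsTransportPlan a b π) (i : ι) : a i ∈ Set.Icc 0 1 ∧ b i ∈ Set.Icc 0 1 := by
  obtain ⟨⟨h0, h1⟩, h2, h3⟩ := h
  rw [Fintype.sum_prod_type] at h1
  refine ⟨⟨h2 i ▸ Finset.sum_nonneg fun _ _ => h0 _, ?_⟩,
    ⟨h3 i ▸ Finset.sum_nonneg fun _ _ => h0 _, ?_⟩⟩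
  · rw [← h1, ← h2 i]
    exact Finset.single_le_sum (f := fun i => ∑ j, π (i, j))
      (fun _ _ => Finset.sum_nonneg fun _ _ => h0 _) (Finset.mem_univ i)
  · rw [Finset.sum_comm] at h1
    rw [← h1, ← h3 i]
    exact Finset.single_le_sum (f := fun j => ∑ i, π (i, j))
      (fun _ _ => Finset.sum_nonneg fun _ _ => h0 _) (Finset.mem_univ i)

/-- Jensen's inequality for the minimal cost `f` of finite transport problems with random weights.
No measurable choice of plans is needed: the mean of `(a, b, f)` stays in the epigraph, which is
convex and closed. -/
theorem exists_isTransportPlan_integral {ι Ω : Type*} [Fintype ι] [MeasurableSpace Ω]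
    (P : Measure Ω) [IsProbabilityMeasure P] {a b : Ω → ι → ℝ} (ha : Measurable a)
    (hb : Measurable b) {c : ι × ι → ℝ} (hc : ∀ q, 0 ≤ c q)
    (h : ∀ ω, ∃ π, IsTransportPlan (a ω) (b ω) π) :
    ∃ f : Ω → ℝ, Measurable f ∧ Integrable f P ∧ (∀ ω, 0 ≤ f ω) ∧
      (∀ ω π, IsTransportPlan (a ω) (b ω) π → f ω ≤ ∑ q, c q * π q) ∧
      ∃ π, IsTransportPlan (fun i => ∫ ω, a ω i ∂P) (fun i => ∫ ω, b ω i ∂P) π ∧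
        ∑ q, c q * π q ≤ ∫ ω, f ω ∂P := by
  let S : Ω → Set ℝ := fun ω => {t | (a ω, b ω, t) ∈ transportEpigraph c}
  have hSc : ∀ ω, IsClosed (S ω) := fun ω =>
    (isClosed_transportEpigraph c).preimage (by fun_prop : Continuous fun t : ℝ => (a ω, b ω, t))
  have hS0 : ∀ ω, ∀ t ∈ S ω, 0 ≤ t := by
    rintro ω t ⟨π, h1, h2⟩
    exact le_trans (Finset.sum_nonneg fun q _ => mul_nonneg (hc q) (h1.1.1 q)) h2
  have hSb : ∀ ω, BddBelow (S ω) := fun ω => ⟨0, fun t ht => hS0 ω t ht⟩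
  have hSπ : ∀ ω π, IsTransportPlan (a ω) (b ω) π → ∑ q, c q * π q ∈ S ω :=
    fun ω π hπ => ⟨π, hπ, le_rfl⟩
  have hSn : ∀ ω, (S ω).Nonempty := fun ω => let ⟨π, hπ⟩ := h ω; ⟨_, hSπ ω π hπ⟩
  have hSm : ∀ ω, sInf (S ω) ∈ S ω := fun ω => (hSc ω).csInf_mem (hSn ω) (hSb ω)
  have hle : ∀ ω π, IsTransportPlan (a ω) (b ω) π → sInf (S ω) ≤ ∑ q, c q * π q :=
    fun ω π hπ => csInf_le (hSb ω) (hSπ ω π hπ)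
  have hmeas : Measurable fun ω => sInf (S ω) := by
    refine measurable_of_Iic fun t => ?_
    have : (fun ω => sInf (S ω)) ⁻¹' Set.Iic t
        = (fun ω => (a ω, b ω, t)) ⁻¹' transportEpigraph c := by
      ext ω
      constructor
      · intro ht
        obtain ⟨π, h1, h2⟩ := hSm ω
        exact ⟨π, h1, h2.trans ht⟩
      · intro ht
        exact csInf_le (hSb ω) ht
    rw [this]
    exact (isClosed_transportEpigraph c).measurableSet.preimage
      (ha.prodMk (hb.prodMk measurable_const))
  have hint : Integrable (fun ω => sInf (S ω)) P := by
    refine Integrable.of_bound hmeas.aestronglyMeasurable (∑ q, c q) (.of_forall fun ω => ?_)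
    obtain ⟨π, hπ⟩ := h ω
    rw [Real.norm_of_nonneg (hS0 ω _ (hSm ω))]
    refine (hle ω π hπ).trans (Finset.sum_le_sum fun q _ => ?_)
    refine mul_le_of_le_one_right (hc q) ?_
    rw [← hπ.1.2]
    exact Finset.single_le_sum (fun q _ => hπ.1.1 q) (Finset.mem_univ q)
  have hai : ∀ i, Integrable (fun ω => a ω i) P := fun i => by
    refine Integrable.of_bound (by fun_prop) 1 (.of_forall fun ω => ?_)
    obtain ⟨π, hπ⟩ := h ω
    rw [Real.norm_of_nonneg (hπ.mem_Icc i).1.1]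
    exact (hπ.mem_Icc i).1.2
  have hbi : ∀ i, Integrable (fun ω => b ω i) P := fun i => by
    refine Integrable.of_bound (by fun_prop) 1 (.of_forall fun ω => ?_)
    obtain ⟨π, hπ⟩ := h ω
    rw [Real.norm_of_nonneg (hπ.mem_Icc i).2.1]
    exact (hπ.mem_Icc i).2.2
  have hai' : Integrable a P := Integrable.of_eval hai
  have hbi' : Integrable b P := Integrable.of_eval hbi
  refine ⟨fun ω => sInf (S ω), hmeas, hint, fun ω => hS0 ω _ (hSm ω), hle, ?_⟩
  have key : ∫ ω, (a ω, b ω, sInf (S ω)) ∂P ∈ transportEpigraph c :=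
    (convex_transportEpigraph c).integral_mem (isClosed_transportEpigraph c)
      (.of_forall hSm) (hai'.prodMk (hbi'.prodMk hint))
  rw [integral_pair hai' (hbi'.prodMk hint), integral_pair hbi' hint] at key
  obtain ⟨π, hπ, h2⟩ := key
  refine ⟨π, ?_, h2⟩
  convert hπ using 1
  · exact funext fun i => (eval_integral hai i).symm
  · exact funext fun i => (eval_integral hbi i).symm

/-! ### Couplings and their discretizations -/

theorem wasserstein_le {X : Type*} [MeasurableSpace X] [EDist X] {p : ℝ} (hp : 0 ≤ p)
    {μ ν : Measure X} {γ : Measure (X × X)} (hγ : γ ∈ couplings μ ν) :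
    wasserstein p μ ν ≤ (∫⁻ z, edist z.1 z.2 ^ p ∂γ) ^ (1 / p) :=
  ENNReal.rpow_le_rpow (iInf₂_le γ hγ) (by positivity)

theorem le_wasserstein {X : Type*} [MeasurableSpace X] [EDist X] {p : ℝ} (hp : 0 < p)
    {μ ν : Measure X} {r : ℝ≥0∞}
    (h : ∀ γ ∈ couplings μ ν, r ≤ (∫⁻ z, edist z.1 z.2 ^ p ∂γ) ^ (1 / p)) :
    r ≤ wasserstein p μ ν := by
  rw [wasserstein, one_div, ENNReal.le_rpow_inv_iff hp]
  refine le_iInf₂ fun γ hγ => ?_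
  rw [← ENNReal.le_rpow_inv_iff hp, ← one_div]
  exact h γ hγ

theorem prod_mem_couplings {X : Type*} [MeasurableSpace X] (μ ν : Measure X)
    [IsProbabilityMeasure μ] [IsProbabilityMeasure ν] : μ.prod ν ∈ couplings μ ν :=
  ⟨inferInstance, by simp [Measure.map_fst_prod], by simp [Measure.map_snd_prod]⟩

theorem lintegral_fst_of_mem_couplings {X : Type*} [MeasurableSpace X] {μ ν : Measure X}
    {γ : Measure (X × X)} (hγ : γ ∈ couplings μ ν) {f : X → ℝ≥0∞} (hf : Measurable f) :
    ∫⁻ z, f z.1 ∂γ = ∫⁻ x, f x ∂μ := by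
  rw [← hγ.2.1, lintegral_map hf measurable_fst]

theorem lintegral_snd_of_mem_couplings {X : Type*} [MeasurableSpace X] {μ ν : Measure X}
    {γ : Measure (X × X)} (hγ : γ ∈ couplings μ ν) {f : X → ℝ≥0∞} (hf : Measurable f) :
    ∫⁻ z, f z.2 ∂γ = ∫⁻ x, f x ∂ν := by
  rw [← hγ.2.2, lintegral_map hf measurable_snd]

theorem lintegral_Lp_le_of_le_add {X : Type*} [MeasurableSpace X] {μ : Measure X} {p : ℝ}
    (hp : 1 ≤ p) {f g₁ g₂ : X → ℝ≥0∞} (h₁ : Measurable g₁) (h₂ : Measurable g₂)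
    (h : ∀ x, f x ≤ g₁ x + g₂ x) :
    (∫⁻ x, f x ^ p ∂μ) ^ (1 / p) ≤
      (∫⁻ x, g₁ x ^ p ∂μ) ^ (1 / p) + (∫⁻ x, g₂ x ^ p ∂μ) ^ (1 / p) := by
  have hp0 : 0 ≤ p := by linarith
  calc (∫⁻ x, f x ^ p ∂μ) ^ (1 / p) ≤ (∫⁻ x, (g₁ + g₂) x ^ p ∂μ) ^ (1 / p) := by
        gcongr with x
        exact h x
    _ ≤ _ := ENNReal.lintegral_Lp_add_le h₁.aemeasurable h₂.aemeasurable hp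

theorem lintegral_Lp_le_of_le_add_add {X : Type*} [MeasurableSpace X] {μ : Measure X} {p : ℝ}
    (hp : 1 ≤ p) {f g₁ g₂ g₃ : X → ℝ≥0∞} (h₁ : Measurable g₁) (h₂ : Measurable g₂)
    (h₃ : Measurable g₃) (h : ∀ x, f x ≤ g₁ x + g₂ x + g₃ x) :
    (∫⁻ x, f x ^ p ∂μ) ^ (1 / p) ≤ (∫⁻ x, g₁ x ^ p ∂μ) ^ (1 / p) +
      (∫⁻ x, g₂ x ^ p ∂μ) ^ (1 / p) + (∫⁻ x, g₃ x ^ p ∂μ) ^ (1 / p) :=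
  (lintegral_Lp_le_of_le_add hp (h₁.add h₂) h₃ h).trans
    (by gcongr; exact lintegral_Lp_le_of_le_add hp h₁ h₂ fun _ => le_rfl)

/-- The `L^p(μ)` distance between the identity and `T`. -/
noncomputable def approxError {U : Type*} [MeasurableSpace U] [EDist U] (p : ℝ) (T : U → U)
    (μ : Measure U) : ℝ≥0∞ :=
  (∫⁻ u, edist u (T u) ^ p ∂μ) ^ (1 / p)

theorem lintegral_edist_comp_eq_sum {U ι : Type*} [PseudoMetricSpace U] [MeasurableSpace U]
    [Fintype ι] [MeasurableSpace ι] [DiscreteMeasurableSpace ι] {κ : U → ι}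
    (hκ : Measurable κ) (x : ι → U) {p : ℝ} (hp : 0 ≤ p) (γ : Measure (U × U)) [IsFiniteMeasure γ] :
    ∫⁻ z, edist (x (κ z.1)) (x (κ z.2)) ^ p ∂γ =
      ENNReal.ofReal (∑ q : ι × ι, dist (x q.1) (x q.2) ^ p * γ.real (Prod.map κ κ ⁻¹' {q})) := by
  have hm : Measurable (Prod.map κ κ) := hκ.prodMap hκ
  have h1 := lintegral_map (μ := γ) (f := fun q : ι × ι => edist (x q.1) (x q.2) ^ p)
    (measurable_of_finite _) hm
  simp only [Prod.map_fst, Prod.map_snd] at h1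
  rw [← h1, lintegral_fintype, ENNReal.ofReal_sum_of_nonneg fun _ _ => by positivity]
  refine Finset.sum_congr rfl fun q _ => ?_
  rw [Measure.map_apply hm (measurableSet_singleton q), ENNReal.ofReal_mul (by positivity),
    ← ENNReal.ofReal_rpow_of_nonneg dist_nonneg hp, edist_dist, ofReal_measureReal]

theorem isTransportPlan_of_mem_couplings {U ι : Type*} [MeasurableSpace U] [Fintype ι]
    [MeasurableSpace ι] [DiscreteMeasurableSpace ι] {κ : U → ι} (hκ : Measurable κ) {μ ν : Measure U}
    {γ : Measure (U × U)} (hγ : γ ∈ couplings μ ν) :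
    IsTransportPlan (fun i => μ.real (κ ⁻¹' {i})) (fun j => ν.real (κ ⁻¹' {j}))
      fun q => γ.real (Prod.map κ κ ⁻¹' {q}) := by
  obtain ⟨_, rfl, rfl⟩ := hγ
  have hm : Measurable (Prod.map κ κ) := hκ.prodMap hκ
  have hms : ∀ q, MeasurableSet (Prod.map κ κ ⁻¹' {q}) := fun q => hm (measurableSet_singleton q)
  have hu : ∀ s : Finset (ι × ι), ∑ q ∈ s, γ.real (Prod.map κ κ ⁻¹' {q}) =
      γ.real (Prod.map κ κ ⁻¹' s) := fun s =>
    sum_measureReal_preimage_singleton s fun q _ => hms q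
  refine ⟨⟨fun q => measureReal_nonneg, by simp [hu]⟩, fun i => ?_, fun j => ?_⟩
  · beta_reduce
    rw [map_measureReal_apply measurable_fst (hκ (measurableSet_singleton i))]
    classical
    rw [← Finset.sum_image (s := Finset.univ) (g := fun j => (i, j))
      (f := fun q => γ.real (Prod.map κ κ ⁻¹' {q})) (by simp [Set.InjOn]), hu]
    congr 1
    ext z
    simp [Prod.ext_iff, eq_comm]
  · beta_reduce
    rw [map_measureReal_apply measurable_snd (hκ (measurableSet_singleton j))]
    classical
    rw [← Finset.sum_image (s := Finset.univ) (g := fun i => (i, j))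
      (f := fun q => γ.real (Prod.map κ κ ⁻¹' {q})) (by simp [Set.InjOn]), hu]
    congr 1
    ext z
    simp [Prod.ext_iff, eq_comm]

/-- A transport plan between the masses of the cells `κ ⁻¹' {i}` is realized by a coupling: inside
each product of cells, take the product of the conditional measures. -/
theorem exists_mem_couplings_of_isTransportPlan {U ι : Type*} [MeasurableSpace U] [Fintype ι]
    [MeasurableSpace ι] [DiscreteMeasurableSpace ι] {κ : U → ι} (hκ : Measurable κ)
    {μ ν : Measure U} [IsProbabilityMeasure μ] [IsProbabilityMeasure ν] {π : ι × ι → ℝ}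
    (hπ : IsTransportPlan (fun i => μ.real (κ ⁻¹' {i})) (fun j => ν.real (κ ⁻¹' {j})) π) :
    ∃ γ ∈ couplings μ ν, ∀ q, γ.real (Prod.map κ κ ⁻¹' {q}) = π q := by
  obtain ⟨⟨h0, -⟩, h1, h2⟩ := hπ
  have hms : ∀ i, MeasurableSet (κ ⁻¹' {i}) := fun i => hκ (measurableSet_singleton i)
  let m : ι → Measure U := fun i => ProbabilityTheory.cond μ (κ ⁻¹' {i})
  let n : ι → Measure U := fun i => ProbabilityTheory.cond ν (κ ⁻¹' {i})
  -- cells charged by the plan have positive mass, so the conditional measures there are not junk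
  have hμ0 : ∀ q, π q ≠ 0 → μ (κ ⁻¹' {q.1}) ≠ 0 := fun q hq h => by
    have h3 := Finset.single_le_sum (f := fun j => π (q.1, j)) (fun j _ => h0 _)
      (Finset.mem_univ q.2)
    simp only [h1 q.1, measureReal_def, h, ENNReal.toReal_zero] at h3
    exact hq (le_antisymm h3 (h0 q))
  have hν0 : ∀ q, π q ≠ 0 → ν (κ ⁻¹' {q.2}) ≠ 0 := fun q hq h => by
    have h3 := Finset.single_le_sum (f := fun i => π (i, q.2)) (fun j _ => h0 _)
      (Finset.mem_univ q.1)
    simp only [h2 q.2, measureReal_def, h, ENNReal.toReal_zero] at h3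
    exact hq (le_antisymm h3 (h0 q))
  let γ : Measure (U × U) := ∑ q, ENNReal.ofReal (π q) • (m q.1).prod (n q.2)
  have hfst : γ.map Prod.fst = μ := by
    rw [Measure.map_finset_sum measurable_fst.aemeasurable]
    have : ∀ q : ι × ι, (ENNReal.ofReal (π q) • (m q.1).prod (n q.2)).map Prod.fst =
        ENNReal.ofReal (π q) • m q.1 := fun q => by
      by_cases hq : π q = 0
      · simp [hq]
      · have : IsProbabilityMeasure (n q.2) := ProbabilityTheory.cond_isProbabilityMeasure (hν0 q hq)
        simp [Measure.map_fst_prod]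
    simp only [this, Fintype.sum_prod_type, ← Finset.sum_smul]
    rw [← ProbabilityTheory.sum_meas_smul_cond_fiber hκ μ]
    refine Finset.sum_congr rfl fun i _ => ?_
    rw [← ENNReal.ofReal_sum_of_nonneg fun _ _ => h0 _, h1 i, ofReal_measureReal]
  have hsnd : γ.map Prod.snd = ν := by
    rw [Measure.map_finset_sum measurable_snd.aemeasurable]
    have : ∀ q : ι × ι, (ENNReal.ofReal (π q) • (m q.1).prod (n q.2)).map Prod.snd =
        ENNReal.ofReal (π q) • n q.2 := fun q => by
      by_cases hq : π q = 0
      · simp [hq]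
      · have : IsProbabilityMeasure (m q.1) := ProbabilityTheory.cond_isProbabilityMeasure (hμ0 q hq)
        simp [Measure.map_snd_prod]
    simp only [this, Fintype.sum_prod_type_right, ← Finset.sum_smul]
    rw [← ProbabilityTheory.sum_meas_smul_cond_fiber hκ ν]
    refine Finset.sum_congr rfl fun i _ => ?_
    rw [← ENNReal.ofReal_sum_of_nonneg fun _ _ => h0 _, h2 i, ofReal_measureReal]
  have hγ : IsProbabilityMeasure γ := ⟨by
    rw [← Set.preimage_univ (f := Prod.fst), ← Measure.map_apply measurable_fst .univ, hfst,
      measure_univ]⟩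
  refine ⟨γ, ⟨hγ, hfst, hsnd⟩, fun q => ?_⟩
  have hcell : Prod.map κ κ ⁻¹' {q} = (κ ⁻¹' {q.1}) ×ˢ (κ ⁻¹' {q.2}) := by
    ext z; simp [Prod.ext_iff]
  have hsum : γ (Prod.map κ κ ⁻¹' {q}) = ENNReal.ofReal (π q) := by
    simp only [γ, Measure.coe_finsetSum, Finset.sum_apply, Measure.smul_apply, smul_eq_mul,
      hcell, Measure.prod_prod]
    rw [Finset.sum_eq_single q]
    · by_cases hq : π q = 0
      · simp [hq]
      · simp only [m, n]
        rw [ProbabilityTheory.cond_apply_self (hμ0 q hq) (measure_ne_top _ _),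
          ProbabilityTheory.cond_apply_self (hν0 q hq) (measure_ne_top _ _), mul_one, mul_one]
    · intro r _ hr
      have hd : ∀ i j : ι, i ≠ j → κ ⁻¹' {i} ∩ κ ⁻¹' {j} = ∅ := fun i j hij => by
        ext u; simp only [Set.mem_inter_iff, Set.mem_preimage, Set.mem_singleton_iff,
          Set.mem_empty_iff_false, iff_false]; rintro ⟨rfl, h⟩; exact hij h
      by_cases h : r.1 = q.1
      · have h' : r.2 ≠ q.2 := fun h' => hr (Prod.ext h h')
        simp [n, ProbabilityTheory.cond_apply (hms _), hd _ _ h']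
      · simp [m, ProbabilityTheory.cond_apply (hms _), hd _ _ h]
    · simp
  rw [measureReal_def, hsum, ENNReal.toReal_ofReal (h0 q)]

/-- A plan between the masses of the cells bounds the Wasserstein distance, up to the error of
discretizing both measures. -/
theorem wasserstein_le_of_isTransportPlan {U ι : Type*} [PseudoMetricSpace U]
    [SecondCountableTopology U] [MeasurableSpace U] [BorelSpace U] [Fintype ι]
    [MeasurableSpace ι] [DiscreteMeasurableSpace ι] {κ : U → ι} (hκ : Measurable κ) (x : ι → U)
    {p : ℝ} (hp : 1 ≤ p) {μ ν : Measure U} [IsProbabilityMeasure μ] [IsProbabilityMeasure ν]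
    {π : ι × ι → ℝ}
    (hπ : IsTransportPlan (fun i => μ.real (κ ⁻¹' {i})) (fun j => ν.real (κ ⁻¹' {j})) π) :
    wasserstein p μ ν ≤ approxError p (x ∘ κ) μ +
      ENNReal.ofReal (∑ q : ι × ι, dist (x q.1) (x q.2) ^ p * π q) ^ (1 / p) +
        approxError p (x ∘ κ) ν := by
  obtain ⟨γ, hγ, hq⟩ := exists_mem_couplings_of_isTransportPlan hκ hπ
  have := hγ.1
  have hp0 : 0 ≤ p := by linarith
  have hT : Measurable (x ∘ κ) := (measurable_of_finite x).comp hκ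
  have he : Measurable fun u => edist u ((x ∘ κ) u) := measurable_id.edist hT
  simp only [← hq]
  rw [← lintegral_edist_comp_eq_sum hκ x hp0 γ, approxError, approxError,
    ← lintegral_fst_of_mem_couplings hγ (he.pow_const p),
    ← lintegral_snd_of_mem_couplings hγ (he.pow_const p)]
  refine (wasserstein_le hp0 hγ).trans (lintegral_Lp_le_of_le_add_add hp
    (he.comp measurable_fst)
    ((hT.comp measurable_fst).edist (hT.comp measurable_snd))
    (he.comp measurable_snd) fun z => ?_)
  rw [Function.comp_apply, Function.comp_apply, edist_comm z.2]
  exact edist_triangle4 _ _ _ _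

/-- A lower bound for the costs of all plans between the masses of the cells is a lower bound for
the Wasserstein distance, up to the error of discretizing both measures. -/
theorem tsub_approxError_le_wasserstein {U ι : Type*} [PseudoMetricSpace U]
    [SecondCountableTopology U] [MeasurableSpace U] [BorelSpace U] [Fintype ι]
    [MeasurableSpace ι] [DiscreteMeasurableSpace ι] {κ : U → ι} (hκ : Measurable κ) (x : ι → U)
    {p : ℝ} (hp : 1 ≤ p) {μ ν : Measure U} {t : ℝ}
    (ht : ∀ π, IsTransportPlan (fun i => μ.real (κ ⁻¹' {i})) (fun j => ν.real (κ ⁻¹' {j})) π →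
      t ≤ ∑ q : ι × ι, dist (x q.1) (x q.2) ^ p * π q) :
    ENNReal.ofReal t ^ (1 / p) - (approxError p (x ∘ κ) μ + approxError p (x ∘ κ) ν) ≤
      wasserstein p μ ν := by
  refine le_wasserstein (by linarith) fun γ hγ => ?_
  have := hγ.1
  have hp0 : 0 ≤ p := by linarith
  have hT : Measurable (x ∘ κ) := (measurable_of_finite x).comp hκ
  have he : Measurable fun u => edist u ((x ∘ κ) u) := measurable_id.edist hT
  rw [tsub_le_iff_left, approxError, approxError,
    ← lintegral_fst_of_mem_couplings hγ (he.pow_const p),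
    ← lintegral_snd_of_mem_couplings hγ (he.pow_const p), add_right_comm]
  refine (ENNReal.rpow_le_rpow (ENNReal.ofReal_le_ofReal
    (ht _ (isTransportPlan_of_mem_couplings hκ hγ))) (by positivity)).trans ?_
  rw [← lintegral_edist_comp_eq_sum hκ x hp0 γ]
  refine lintegral_Lp_le_of_le_add_add hp (he.comp measurable_fst) (measurable_edist)
    (he.comp measurable_snd) fun z => ?_
  rw [Function.comp_apply, Function.comp_apply, edist_comm z.1 (x (κ z.1))]
  exact edist_triangle4 _ _ _ _

/-! ### Moments -/

theorem pMoment_rpow_le_wasserstein_add {U : Type*} [NormedAddCommGroup U]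
    [SecondCountableTopology U] [MeasurableSpace U] [BorelSpace U] {p : ℝ} (hp : 1 ≤ p)
    (μ ν : Measure U) :
    pMoment p μ ^ (1 / p) ≤ pMoment p ν ^ (1 / p) + wasserstein p μ ν := by
  rw [← tsub_le_iff_left]
  refine le_wasserstein (by linarith) fun γ hγ => ?_
  rw [tsub_le_iff_left, pMoment, pMoment,
    ← lintegral_fst_of_mem_couplings hγ (measurable_enorm.pow_const p),
    ← lintegral_snd_of_mem_couplings hγ (measurable_enorm.pow_const p)]
  refine lintegral_Lp_le_of_le_add hp (measurable_enorm.comp measurable_snd) measurable_edist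
    fun z => ?_
  rw [edist_eq_enorm_sub]
  simpa using enorm_add_le z.2 (z.1 - z.2)

theorem wasserstein_le_pMoment_rpow_add {U : Type*} [NormedAddCommGroup U]
    [MeasurableSpace U] [BorelSpace U] {p : ℝ} (hp : 1 ≤ p)
    (μ ν : Measure U) [IsProbabilityMeasure μ] [IsProbabilityMeasure ν] :
    wasserstein p μ ν ≤ pMoment p μ ^ (1 / p) + pMoment p ν ^ (1 / p) := by
  have hγ := prod_mem_couplings μ ν
  rw [pMoment, pMoment,
    ← lintegral_fst_of_mem_couplings hγ (measurable_enorm.pow_const p),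
    ← lintegral_snd_of_mem_couplings hγ (measurable_enorm.pow_const p)]
  refine (wasserstein_le (by linarith) hγ).trans (lintegral_Lp_le_of_le_add hp
    (measurable_enorm.comp measurable_fst) (measurable_enorm.comp measurable_snd) fun z => ?_)
  rw [edist_eq_enorm_sub]
  exact enorm_sub_le

theorem rpow_one_div_rpow {p : ℝ} (hp : p ≠ 0) (a : ℝ≥0∞) : (a ^ (1 / p)) ^ p = a := by
  rw [one_div, ENNReal.rpow_inv_rpow hp]

theorem rpow_le_of_le_rpow_add_rpow {p : ℝ} (hp : 1 ≤ p) {w x y : ℝ≥0∞}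
    (h : w ≤ x ^ (1 / p) + y ^ (1 / p)) : w ^ p ≤ 2 ^ (p - 1) * (x + y) := by
  have hp0 : p ≠ 0 := by linarith
  calc w ^ p ≤ (x ^ (1 / p) + y ^ (1 / p)) ^ p := ENNReal.rpow_le_rpow h (by linarith)
    _ ≤ 2 ^ (p - 1) * ((x ^ (1 / p)) ^ p + (y ^ (1 / p)) ^ p) :=
      ENNReal.rpow_add_le_mul_rpow_add_rpow _ _ hp
    _ = _ := by rw [rpow_one_div_rpow hp0, rpow_one_div_rpow hp0]

theorem two_rpow_ne_top (q : ℝ) : (2 : ℝ≥0∞) ^ q ≠ ∞ := by simp [ENNReal.rpow_eq_top_iff]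

/-! ### Mixtures -/

theorem WassersteinSpace.measurable_lintegral {p : ℝ} {U : Type*} [MeasurableSpace U]
    [NormedAddCommGroup U] {f : U → ℝ≥0∞} (hf : Measurable f) :
    Measurable fun μ : WassersteinSpace p U => ∫⁻ u, f u ∂μ.toMeasure :=
  (Measure.measurable_lintegral hf).comp WassersteinSpace.measurable_toMeasure

theorem lintegral_mixture {p : ℝ} {U : Type*} [MeasurableSpace U] [NormedAddCommGroup U]
    (Q : Measure (WassersteinSpace p U)) {f : U → ℝ≥0∞} (hf : Measurable f) :
    ∫⁻ u, f u ∂(mixture Q) = ∫⁻ μ, ∫⁻ u, f u ∂μ.toMeasure ∂Q :=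
  Measure.lintegral_bind WassersteinSpace.measurable_toMeasure.aemeasurable hf.aemeasurable

theorem isProbabilityMeasure_mixture {p : ℝ} {U : Type*} [MeasurableSpace U]
    [NormedAddCommGroup U] (Q : Measure (WassersteinSpace p U)) [IsProbabilityMeasure Q] :
    IsProbabilityMeasure (mixture Q) := ⟨by
  have h : ∀ μ : WassersteinSpace p U, μ.toMeasure Set.univ = 1 := fun μ => μ.2.1.measure_univ
  simp [mixture_apply Q .univ, h]⟩

theorem integral_real_toMeasure {p : ℝ} {U : Type*} [MeasurableSpace U]
    [NormedAddCommGroup U] (Q : Measure (WassersteinSpace p U)) {A : Set U}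
    (hA : MeasurableSet A) :
    ∫ μ, μ.toMeasure.real A ∂Q = (mixture Q).real A := by
  have hm : Measurable fun μ : WassersteinSpace p U => μ.toMeasure A :=
    (Measure.measurable_coe hA).comp WassersteinSpace.measurable_toMeasure
  simp only [measureReal_def]
  rw [mixture_apply Q hA, integral_toReal hm.aemeasurable]
  refine .of_forall fun μ => ?_
  have : IsProbabilityMeasure μ.toMeasure := μ.2.1
  exact measure_lt_top _ _

theorem MemPpPp.memPp_mixture {p : ℝ} {U : Type*} [NormedAddCommGroup U]
    [SecondCountableTopology U] [MeasurableSpace U] [BorelSpace U] (hp : 1 ≤ p)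
    {Q : Measure (WassersteinSpace p U)} (hQ : MemPpPp Q) : MemPp p (mixture Q) := by
  obtain ⟨hQ1, μ₀, hμ₀⟩ := hQ
  refine ⟨isProbabilityMeasure_mixture Q, ?_⟩
  have hle : ∀ μ : WassersteinSpace p U, pMoment p μ.toMeasure ≤
      2 ^ (p - 1) * (pMoment p μ₀.toMeasure + edist μ μ₀ ^ p) := fun μ => by
    have hr : ∀ a : ℝ≥0∞, (a ^ p) ^ (1 / p) = a := fun a => by
      rw [← ENNReal.rpow_mul, mul_one_div_cancel (by linarith), ENNReal.rpow_one]
    have h := pMoment_rpow_le_wasserstein_add hp μ.toMeasure μ₀.toMeasure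
    rw [← hr (wasserstein p μ.toMeasure μ₀.toMeasure)] at h
    have h' := rpow_le_of_le_rpow_add_rpow hp h
    rwa [rpow_one_div_rpow (by linarith)] at h'
  have : pMoment p (mixture Q) = ∫⁻ μ, pMoment p μ.toMeasure ∂Q :=
    lintegral_mixture Q (measurable_enorm.pow_const p)
  rw [this]
  refine (lintegral_mono hle).trans_lt ?_
  rw [lintegral_const_mul' _ _ (two_rpow_ne_top _), lintegral_add_left measurable_const,
    lintegral_const, measure_univ, mul_one]
  exact ENNReal.mul_lt_top (two_rpow_ne_top _).lt_top
    (ENNReal.add_lt_top.2 ⟨μ₀.2.2, hμ₀⟩)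

theorem MemPpPp.wasserstein_lt_top {p : ℝ} {U : Type*} [NormedAddCommGroup U]
    [SecondCountableTopology U] [MeasurableSpace U] [BorelSpace U] (hp : 1 ≤ p)
    {Q Q' : Measure (WassersteinSpace p U)} (hQ : MemPpPp Q) (hQ' : MemPpPp Q') :
    wasserstein p Q Q' < ∞ := by
  have := hQ.1
  have := hQ'.1
  have hγ := prod_mem_couplings Q Q'
  have hm : Measurable fun μ : WassersteinSpace p U => pMoment p μ.toMeasure :=
    WassersteinSpace.measurable_lintegral (measurable_enorm.pow_const p)
  have hle : ∀ z : WassersteinSpace p U × WassersteinSpace p U, edist z.1 z.2 ^ p ≤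
      2 ^ (p - 1) * (pMoment p z.1.toMeasure + pMoment p z.2.toMeasure) := fun z => by
    have : IsProbabilityMeasure z.1.toMeasure := z.1.2.1
    have : IsProbabilityMeasure z.2.toMeasure := z.2.2.1
    exact rpow_le_of_le_rpow_add_rpow hp (wasserstein_le_pMoment_rpow_add hp _ _)
  refine (wasserstein_le (by linarith) hγ).trans_lt
    (ENNReal.rpow_lt_top_of_nonneg (by positivity) ((lintegral_mono hle).trans_lt ?_).ne)
  rw [lintegral_const_mul' _ _ (two_rpow_ne_top _),
    lintegral_add_left (f := fun z : WassersteinSpace p U × WassersteinSpace p U =>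
      pMoment p z.1.toMeasure) (hm.comp measurable_fst), lintegral_fst_of_mem_couplings hγ hm,
    lintegral_snd_of_mem_couplings hγ hm]
  refine ENNReal.mul_lt_top (two_rpow_ne_top _).lt_top (ENNReal.add_lt_top.2 ⟨?_, ?_⟩)
  · rw [show ∫⁻ μ, pMoment p μ.toMeasure ∂Q = pMoment p (mixture Q) from
      (lintegral_mixture Q (measurable_enorm.pow_const p)).symm]
    exact (hQ.memPp_mixture hp).2
  · rw [show ∫⁻ μ, pMoment p μ.toMeasure ∂Q' = pMoment p (mixture Q') from
      (lintegral_mixture Q' (measurable_enorm.pow_const p)).symm]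
    exact (hQ'.memPp_mixture hp).2

/-! ### Comparison of the Wasserstein distances -/

/-- The identity is approximated in `L^p(ρ)` by maps with finite range. -/
theorem exists_simpleFunc_approxError_le {U : Type*} [NormedAddCommGroup U]
    [SecondCountableTopology U] [MeasurableSpace U] [BorelSpace U] {p : ℝ} (hp : 1 ≤ p)
    {ρ : Measure U} (hρ : pMoment p ρ < ∞) {ε : ℝ≥0∞} (hε : ε ≠ 0) :
    ∃ T : SimpleFunc U U, approxError p T ρ ≤ ε := by
  have hp0 : 0 < p := by linarith
  have h0 : ENNReal.ofReal p ≠ 0 := by simpa using hp0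
  have hid : MemLp (id : U → U) (ENNReal.ofReal p) ρ := by
    refine ⟨measurable_id.aestronglyMeasurable, ?_⟩
    rw [eLpNorm_eq_lintegral_rpow_enorm_toReal h0 ENNReal.ofReal_ne_top,
      ENNReal.toReal_ofReal hp0.le]
    exact ENNReal.rpow_lt_top_of_nonneg (by positivity) hρ.ne
  obtain ⟨T, hT, -⟩ := hid.exists_simpleFunc_eLpNorm_sub_lt ENNReal.ofReal_ne_top hε
  rw [eLpNorm_eq_lintegral_rpow_enorm_toReal h0 ENNReal.ofReal_ne_top,
      ENNReal.toReal_ofReal hp0.le] at hT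
  refine ⟨T, ?_⟩
  simp only [approxError, edist_eq_enorm_sub]
  exact hT.le

theorem approxError_mono {U : Type*} [MeasurableSpace U] [EDist U] {p : ℝ} (hp : 0 ≤ p)
    (T : U → U) {μ ν : Measure U} (h : μ ≤ ν) : approxError p T μ ≤ approxError p T ν :=
  ENNReal.rpow_le_rpow (lintegral_mono' h le_rfl) (by positivity)

/-- The `L^p(Q)` norm of the discretization errors is the discretization error of the mixture. -/
theorem lintegral_approxError_rpow {p : ℝ} (hp : 1 ≤ p) {U : Type*} [MeasurableSpace U]
    [NormedAddCommGroup U] [SecondCountableTopology U] [BorelSpace U]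
    (Q : Measure (WassersteinSpace p U)) {T : U → U} (hT : Measurable T) :
    (∫⁻ μ, approxError p T μ.toMeasure ^ p ∂Q) ^ (1 / p) = approxError p T (mixture Q) := by
  have hr : ∀ a : ℝ≥0∞, (a ^ (1 / p)) ^ p = a := rpow_one_div_rpow (by linarith)
  simp only [approxError, hr]
  have he : Measurable fun u => edist u (T u) := measurable_id.edist hT
  rw [lintegral_mixture Q (he.pow_const p)]

/-- The comparison with the cost of a coupling `Γ` of `Q` and `Q'`, up to discretization. The
distance on the Wasserstein space need not be known to be measurable: it is only bounded below,
by a measurable function. -/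
theorem wasserstein_mixture_le_of_mem_couplings {U ι : Type*} [NormedAddCommGroup U]
    [SecondCountableTopology U] [MeasurableSpace U] [BorelSpace U] [Fintype ι]
    [MeasurableSpace ι] [DiscreteMeasurableSpace ι] {κ : U → ι} (hκ : Measurable κ) (x : ι → U)
    {p : ℝ} (hp : 1 ≤ p) {Q Q' : Measure (WassersteinSpace p U)} [IsProbabilityMeasure Q]
    [IsProbabilityMeasure Q'] {Γ : Measure (WassersteinSpace p U × WassersteinSpace p U)}
    (hΓ : Γ ∈ couplings Q Q') :
    wasserstein p (mixture Q) (mixture Q') ≤ (∫⁻ z, edist z.1 z.2 ^ p ∂Γ) ^ (1 / p) +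
      2 * (approxError p (x ∘ κ) (mixture Q) + approxError p (x ∘ κ) (mixture Q')) := by
  have := hΓ.1
  have := isProbabilityMeasure_mixture Q
  have := isProbabilityMeasure_mixture Q'
  have hp0 : 0 ≤ p := by linarith
  have hms : ∀ i, MeasurableSet (κ ⁻¹' {i}) := fun i => hκ (measurableSet_singleton i)
  have hw : Measurable fun μ : WassersteinSpace p U => fun i => μ.toMeasure.real (κ ⁻¹' {i}) :=
    measurable_pi_lambda _ fun i =>
      ((Measure.measurable_coe (hms i)).comp WassersteinSpace.measurable_toMeasure).ennreal_toReal
  obtain ⟨f, hfm, hfi, hf0, hfle, π, hπ, hπf⟩ := exists_isTransportPlan_integral Γ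
    (a := fun z i => z.1.toMeasure.real (κ ⁻¹' {i}))
    (b := fun z i => z.2.toMeasure.real (κ ⁻¹' {i}))
    (c := fun q => dist (x q.1) (x q.2) ^ p)
    (hw.comp measurable_fst) (hw.comp measurable_snd) (fun q => by positivity) fun z => by
      have : IsProbabilityMeasure z.1.toMeasure := z.1.2.1
      have : IsProbabilityMeasure z.2.toMeasure := z.2.2.1
      exact ⟨_, isTransportPlan_of_mem_couplings hκ (prod_mem_couplings _ _)⟩
  have h1 : ∀ i, ∫ z, z.1.toMeasure.real (κ ⁻¹' {i}) ∂Γ = (mixture Q).real (κ ⁻¹' {i}) :=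
    fun i => by
      rw [← integral_real_toMeasure Q (hms i)]
      conv_rhs => rw [← hΓ.2.1]
      exact (integral_map measurable_fst.aemeasurable
        ((measurable_pi_apply i).comp hw).aestronglyMeasurable).symm
  have h2 : ∀ i, ∫ z, z.2.toMeasure.real (κ ⁻¹' {i}) ∂Γ = (mixture Q').real (κ ⁻¹' {i}) :=
    fun i => by
      rw [← integral_real_toMeasure Q' (hms i)]
      conv_rhs => rw [← hΓ.2.2]
      exact (integral_map measurable_snd.aemeasurable
        ((measurable_pi_apply i).comp hw).aestronglyMeasurable).symm
  simp only [h1, h2] at hπ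
  have hT : Measurable (x ∘ κ) := (measurable_of_finite x).comp hκ
  have hem : Measurable fun μ : WassersteinSpace p U => approxError p (x ∘ κ) μ.toMeasure :=
    (WassersteinSpace.measurable_lintegral
      ((measurable_id.edist hT).pow_const p)).pow_const (1 / p)
  have hgm : Measurable fun z => ENNReal.ofReal (f z) ^ (1 / p) :=
    hfm.ennreal_ofReal.pow_const _
  -- Minkowski's inequality needs measurable summands, hence the truncated difference instead of the
  -- distance on the Wasserstein space
  have hmink := lintegral_Lp_le_of_le_add_add (μ := Γ) hp
    (f := fun z => ENNReal.ofReal (f z) ^ (1 / p))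
    (hem.comp measurable_fst)
    (hgm.sub ((hem.comp measurable_fst).add (hem.comp measurable_snd)))
    (hem.comp measurable_snd) fun z => by
      rw [add_right_comm]
      exact le_add_tsub
  have hr : ∀ a : ℝ≥0∞, (a ^ (1 / p)) ^ p = a := rpow_one_div_rpow (by linarith)
  have e1 : (∫⁻ z, approxError p (x ∘ κ) z.1.toMeasure ^ p ∂Γ) ^ (1 / p) =
      approxError p (x ∘ κ) (mixture Q) := by
    rw [lintegral_fst_of_mem_couplings hΓ (hem.pow_const p), lintegral_approxError_rpow hp Q hT]
  have e2 : (∫⁻ z, approxError p (x ∘ κ) z.2.toMeasure ^ p ∂Γ) ^ (1 / p) =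
      approxError p (x ∘ κ) (mixture Q') := by
    rw [lintegral_snd_of_mem_couplings hΓ (hem.pow_const p), lintegral_approxError_rpow hp Q' hT]
  simp only [hr, Function.comp_def] at hmink
  simp only [Function.comp_def] at e1 e2 ⊢
  rw [e1, e2, ← ofReal_integral_eq_lintegral_ofReal hfi (.of_forall hf0)] at hmink
  have hmid : (∫⁻ z : WassersteinSpace p U × WassersteinSpace p U,
      (ENNReal.ofReal (f z) ^ (1 / p) - (approxError p (x ∘ κ) z.1.toMeasure +
        approxError p (x ∘ κ) z.2.toMeasure)) ^ p ∂Γ) ^ (1 / p) ≤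
      (∫⁻ z, edist z.1 z.2 ^ p ∂Γ) ^ (1 / p) := by
    gcongr with z
    exact tsub_approxError_le_wasserstein hκ x hp (hfle z)
  have hup := wasserstein_le_of_isTransportPlan hκ x hp hπ
  calc _ ≤ _ := hup
    _ ≤ approxError p (x ∘ κ) (mixture Q) + (approxError p (x ∘ κ) (mixture Q) +
        (∫⁻ z, edist z.1 z.2 ^ p ∂Γ) ^ (1 / p) + approxError p (x ∘ κ) (mixture Q')) +
        approxError p (x ∘ κ) (mixture Q') := by
      gcongr
      refine (ENNReal.rpow_le_rpow (ENNReal.ofReal_le_ofReal hπf) (by positivity)).trans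
        (hmink.trans ?_)
      exact add_le_add (add_le_add le_rfl hmid) le_rfl
    _ = _ := by simp only [Function.comp_def]; ring

theorem wasserstein_mixture_le {U : Type*} [NormedAddCommGroup U]
    [SecondCountableTopology U] [MeasurableSpace U] [BorelSpace U] {p : ℝ} (hp : 1 ≤ p)
    {Q Q' : Measure (WassersteinSpace p U)} (hQ : MemPpPp Q) (hQ' : MemPpPp Q') :
    wasserstein p (mixture Q) (mixture Q') ≤ wasserstein p Q Q' := by
  have := hQ.1
  have := hQ'.1
  refine le_wasserstein (by linarith) fun Γ hΓ => ?_
  refine ENNReal.le_of_forall_pos_le_add fun ε hε _ => ?_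
  have hρ : pMoment p (mixture Q + mixture Q') < ∞ := by
    rw [pMoment, lintegral_add_measure]
    exact ENNReal.add_lt_top.2 ⟨(hQ.memPp_mixture hp).2, (hQ'.memPp_mixture hp).2⟩
  -- one map `T` for both mixtures; its error enters the comparison four times
  obtain ⟨T, hT⟩ := exists_simpleFunc_approxError_le hp hρ (ε := (ε / 4 : NNReal))
    (by simpa using hε.ne')
  have h1 : approxError p T (mixture Q) ≤ (ε / 4 : NNReal) :=
    (approxError_mono (by linarith) T (Measure.le_add_right le_rfl)).trans hT
  have h2 : approxError p T (mixture Q') ≤ (ε / 4 : NNReal) :=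
    (approxError_mono (by linarith) T (Measure.le_add_left le_rfl)).trans hT
  have hκ : Measurable fun u => (⟨T u, T.mem_range_self u⟩ : T.range) :=
    T.measurable.subtype_mk
  refine (wasserstein_mixture_le_of_mem_couplings hκ Subtype.val hp hΓ).trans ?_
  gcongr
  calc _ ≤ 2 * (((ε / 4 : NNReal) : ℝ≥0∞) + (ε / 4 : NNReal)) := by
        gcongr
        · exact h1
        · exact h2
    _ = ε := by
        norm_cast
        rw [← two_mul, ← mul_assoc, mul_div_left_comm]
        norm_num

theorem mainTheorem7 {U : Type*} [NormedAddCommGroup U] [InnerProductSpace ℝ U]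
    [CompleteSpace U] [TopologicalSpace.SeparableSpace U] [MeasurableSpace U] [BorelSpace U]
    (p : ℝ) (hp : 1 ≤ p) (Q Q' : Measure (WassersteinSpace p U))
    (hQ : MemPpPp Q) (hQ' : MemPpPp Q') :
    MemPp p (mixture Q) ∧ MemPp p (mixture Q') ∧ wasserstein p Q Q' < ∞ ∧
      wasserstein p (mixture Q) (mixture Q') ≤ wasserstein p Q Q' := by
  have : SecondCountableTopology U := UniformSpace.secondCountable_of_separable U
  exact ⟨hQ.memPp_mixture hp, hQ'.memPp_mixture hp, hQ.wasserstein_lt_top hp hQ',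
    wasserstein_mixture_le hp hQ hQ'⟩
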